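/- Let $\mathrm{FSym}(\mathbb{Z})$ be the group of bijections of $\mathbb{Z}$ that fix all but finitely many integers, let $\mathbb{Z}$ act on it by $(h\cdot f)(x)=h+f(x-h)$, and let $G=\mathrm{FSym}(\mathbb{Z})\rtimes\mathbb{Z}$ with projection $\pi:G\to\mathbb{Z}$. For a probability measure $\mu$ on a countable group, the $\mu$-random walk is $g_1,\ g_1g_2,\ g_1g_2g_3,\dots$ with $g_1,g_2,\dots$ independent of law $\mu$, and its Poisson boundary is the quotient of the space of trajectories by the equivalence relation generated by the shift $(x_1,x_2,\dots)\mapsto(x_2,x_3,\dots)$, with the measurable sets and the measure induced from the trajectories; it is trivial if all its measurable sets have measure $0$ or $1$. **Proposition.** There exists a probability measure $\mu$ on $G$ which is non-degenerate (its support generates $G$ as a semigroup) and symmetric ($\mu(g^{-1})=\mu(g)$ for all $g\in G$), such that the random walk on $\mathbb{Z}$ with step distribution $\pi_*\mu$ is transient (almost surely every integer is visited only finitely many times) and the Poisson boundary of $(G,\mu)$ is trivial. -/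

import Mathlib

open MeasureTheory ProbabilityTheory

noncomputable section

/-! ### The lampshuffler group -/

section LampshufflerGroup

variable (H : Type*)

/-- The group `FSym(H)` of finitary permutations of `H`: the bijections `f : H → H` such that
`f x ≠ x` for only finitely many `x`, under composition. -/
def FSym : Subgroup (Equiv.Perm H) where
  carrier := {f | {x | f x ≠ x}.Finite}
  one_mem' := by simp
  mul_mem' := by
    intro f g hf hg
    refine (Set.Finite.union hf hg).subset fun x hx => ?_
    simp only [Set.mem_ofPred_eq, Set.mem_union, Equiv.Perm.mul_apply] at hx ⊢
    by_contra! h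
    exact hx (by rw [h.2, h.1])
  inv_mem' := by
    intro f hf
    refine Set.Finite.subset hf fun x hx hfx => hx ?_
    exact Equiv.Perm.inv_eq_iff_eq.2 hfx.symm

variable {H}

theorem mem_FSym {f : Equiv.Perm H} : f ∈ FSym H ↔ {x | f x ≠ x}.Finite := Iff.rfl

instance FSym.normal : (FSym H).Normal where
  conj_mem f hf g := by
    refine (Set.Finite.image g hf).subset fun x hx => ⟨g⁻¹ x, fun h => hx ?_, by simp⟩
    rw [Equiv.Perm.mul_apply, Equiv.Perm.mul_apply, h]
    exact g.apply_symm_apply x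

instance FSym.countable [Countable H] : Countable (FSym H) := by
  classical
  let F : FSym H → Finset (H × H) := fun f =>
    (mem_FSym.1 f.2).toFinset.image fun x => (x, (f : Equiv.Perm H) x)
  have key : ∀ (f : FSym H) (x y : H),
      (x, y) ∈ F f ↔ (f : Equiv.Perm H) x ≠ x ∧ (f : Equiv.Perm H) x = y := by
    intro f x y
    simp only [F, Finset.mem_image, Set.Finite.mem_toFinset, Set.mem_ofPred_eq, Prod.mk.injEq]
    constructor
    · rintro ⟨a, ha, rfl, rfl⟩
      exact ⟨ha, rfl⟩
    · rintro ⟨h, rfl⟩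
      exact ⟨x, h, rfl, rfl⟩
  refine Function.Injective.countable (f := F) fun f g hfg => Subtype.ext (Equiv.ext fun x => ?_)
  by_cases hf : (f : Equiv.Perm H) x = x
  · by_cases hg : (g : Equiv.Perm H) x = x
    · rw [hf, hg]
    · have h := (key g x _).2 ⟨hg, rfl⟩
      rw [← hfg] at h
      exact ((key f x _).1 h).2
  · have h := (key f x _).2 ⟨hf, rfl⟩
    rw [hfg] at h
    exact ((key g x _).1 h).2.symm

variable (H) in
/-- The action of `H` on `FSym(H)` by group automorphisms, `(h · f)(x) = h f(h⁻¹ x)`, that is,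
conjugation by the left translation by `h`. -/
def FSym.action [Group H] : H →* MulAut (FSym H) :=
  (MulAut.conjNormal (H := FSym H)).comp (MulAction.toPermHom H H)

theorem FSym.action_apply [Group H] (h : H) (f : FSym H) (x : H) :
    (FSym.action H h f : Equiv.Perm H) x = h * (f : Equiv.Perm H) (h⁻¹ * x) := by
  simp [FSym.action, Equiv.Perm.mul_apply]

variable (H) in
/-- The lampshuffler group `FSym(H) ⋊ H`. -/
abbrev Lampshuffler [Group H] : Type _ := FSym H ⋊[FSym.action H] H

/-- Countable groups carry the discrete `σ`-algebra. -/
instance Lampshuffler.measurableSpace [Group H] : MeasurableSpace (Lampshuffler H) := ⊤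

instance Lampshuffler.discreteMeasurableSpace [Group H] :
    DiscreteMeasurableSpace (Lampshuffler H) := ⟨fun _ => trivial⟩

instance Lampshuffler.countable [Group H] [Countable H] : Countable (Lampshuffler H) :=
  Function.Injective.countable (f := fun g : Lampshuffler H => (g.left, g.right))
    fun _ _ h => SemidirectProduct.ext (Prod.ext_iff.1 h).1 (Prod.ext_iff.1 h).2

instance : MeasurableSpace (Multiplicative ℤ) := ⊤

instance : DiscreteMeasurableSpace (Multiplicative ℤ) := ⟨fun _ => trivial⟩

end LampshufflerGroup

/-! ### Random walks on countable groups and the Poisson boundary -/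

section RandomWalk

variable {G : Type*}

variable (G) in
/-- Orbit equivalence of trajectories: they coincide from some times on, after a time shift. -/
def orbitSetoid : Setoid (ℕ → G) where
  r x y := ∃ p q : ℕ, ∀ n, x (p + n) = y (q + n)
  iseqv :=
    { refl := fun _ => ⟨0, 0, fun _ => rfl⟩
      symm := fun ⟨p, q, h⟩ => ⟨q, p, fun n => (h n).symm⟩
      trans := by
        rintro x y z ⟨p, q, h⟩ ⟨p', q', h'⟩
        refine ⟨p + p', q' + q, fun n => ?_⟩
        rw [add_assoc, h, show q + (p' + n) = p' + (q + n) by omega, h', add_assoc] }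

variable (G) in
/-- The Poisson boundary as a space: the quotient of the space of trajectories by orbit
equivalence. Its measurable sets are those whose preimage among the trajectories is measurable,
so they correspond to the measurable unions of orbit equivalence classes. -/
def PoissonBoundary : Type _ := Quotient (orbitSetoid G)

/-- The quotient map from trajectories to the Poisson boundary. -/
def PoissonBoundary.bnd (x : ℕ → G) : PoissonBoundary G := Quotient.mk (orbitSetoid G) x

instance PoissonBoundary.measurableSpace [MeasurableSpace G] : MeasurableSpace (PoissonBoundary G) :=
  MeasurableSpace.map PoissonBoundary.bnd MeasurableSpace.pi

theorem PoissonBoundary.measurable_bnd [MeasurableSpace G] :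
    Measurable (PoissonBoundary.bnd : (ℕ → G) → PoissonBoundary G) :=
  fun _ hs => hs

variable [Group G]

/-- The map `(g₁, g₂, g₃, …) ↦ (g₁, g₁g₂, g₁g₂g₃, …)` from increments to trajectories
(the entry of index `n : ℕ` is the position at time `n + 1`). -/
def walkTrajectory (g : ℕ → G) : ℕ → G
  | 0 => g 0
  | n + 1 => walkTrajectory g n * g (n + 1)

/-- `μ` is symmetric: `μ(g⁻¹) = μ(g)`. -/
def IsSymmetricLaw (μ : PMF G) : Prop := ∀ g : G, μ g⁻¹ = μ g

/-- `μ` is non-degenerate: its support generates `G` as a semigroup. -/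
def IsNonDegenerateLaw (μ : PMF G) : Prop := Subsemigroup.closure μ.support = ⊤

variable [MeasurableSpace G] [DiscreteMeasurableSpace G] [Countable G]

theorem measurable_walkTrajectory : Measurable (walkTrajectory : (ℕ → G) → ℕ → G) := by
  refine measurable_pi_lambda _ fun n => ?_
  induction n with
  | zero => exact measurable_pi_apply 0
  | succ n ih => exact ih.mul (measurable_pi_apply (n + 1))

/-- The law `ℙ` on the space of trajectories of the `μ`-random walk started at the identity: the
push-forward of the Bernoulli measure `μ^ℕ` on increments. -/
def walkLaw (μ : PMF G) : Measure (ℕ → G) :=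
  (Measure.infinitePi fun _ : ℕ => μ.toMeasure).map walkTrajectory

instance walkLaw.isProbabilityMeasure (μ : PMF G) : IsProbabilityMeasure (walkLaw μ) :=
  Measure.isProbabilityMeasure_map measurable_walkTrajectory.aemeasurable

/-- The `μ`-random walk is transient: almost surely, every element of `G` is visited only
finitely many times. -/
def IsTransientWalk (μ : PMF G) : Prop :=
  ∀ᵐ x ∂walkLaw μ, ∀ g : G, {n : ℕ | x n = g}.Finite

/-- The harmonic measure on the Poisson boundary of `(G, μ)`. -/
def harmonicMeasure (μ : PMF G) : Measure (PoissonBoundary G) :=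
  (walkLaw μ).map PoissonBoundary.bnd

instance harmonicMeasure.isProbabilityMeasure (μ : PMF G) :
    IsProbabilityMeasure (harmonicMeasure μ) :=
  Measure.isProbabilityMeasure_map PoissonBoundary.measurable_bnd.aemeasurable

/-- The Poisson boundary of `(G, μ)` is trivial: as a measure space it is a point modulo null
sets, i.e. every measurable set has harmonic measure `0` or `1`. -/
def HasTrivialPoissonBoundary (μ : PMF G) : Prop :=
  ∀ A : Set (PoissonBoundary G), MeasurableSet A → harmonicMeasure μ A = 0 ∨ harmonicMeasure μ A = 1

end RandomWalk

end

/-!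
The law is a mixture `μ = ∑ₖ 2 ^ (-(k + 1)) νₖ` of step laws at rapidly growing scales
`Nₖ = 256 ^ (k ^ 2)`. With `t` the unit translation, `νₖ` is the law of `t ^ m * σ * t ^ (-m')`,
where `m`, `m'` are uniform in `[0, Nₖ)` and `σ` is a uniform permutation supported in
`[-3Nₖ, 3Nₖ]`. Each `νₖ` is symmetric, and the supports exhaust the group.

*Almost invariance.* If `z = (τ, a)` has `|a| ≤ r` and `τ` supported in `[-r, r]`, with `r ≤ Nₖ`,
then left translation of `νₖ` by `z` only shifts `m` by `a`, because the conjugate of `τ` by a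
translation of length at most `2Nₖ` is still supported in `[-3Nₖ, 3Nₖ]` and is absorbed by `σ`.
Hence averages against `νₖ` from two points of the ball of radius `r` differ by at most `2r / Nₖ`
(`expect_stepLaw_le`).

*Triviality of the boundary.* Let `h` be harmonic with values in `[0, 1]`. With overwhelming
probability one of the first `4 ^ M` steps has a scale beyond `N_M`; before the first such step the
walk stays in a ball much smaller than `N_{M + 1}`, and that step forgets the starting point. This
gives `h z ≤ h w + o(1)` as `M → ∞`, so `h` is constant (`harmonic_le_add_on_ball`,
`harmonic_le`). Applied to the probability that the walk started at `z` lies in a shift-invariant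
event, this shows that such an event is independent of finitely many increments, hence of itself
(`hitProb_eq_zero_or_one`).

*Transience.* On `ℤ`, a step at scale `Nₖ` spreads the walk so that no point has probability more
than `1 / Nₖ`. After `n + 1` steps no point has probability more than
`(1 - 2 ^ (-(M + 1))) ^ n + 1 / N_{M + 1}` (`visitProb_projectedLaw_le`), and for `16 ^ M ≈ n` this
is `O(n ^ (-3 / 2))`, which is summable; the Borel–Cantelli lemma concludes.
-/

open scoped ENNReal

namespace Lampwalk

/-! ### Expectations with respect to a discrete law -/

section Expect

variable {α β : Type*}

/-- The expectation of a nonnegative function with respect to a probability mass function. -/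
noncomputable def expect (p : PMF α) (f : α → ℝ≥0∞) : ℝ≥0∞ := ∑' a, p a * f a

theorem expect_bind (p : PMF α) (q : α → PMF β) (f : β → ℝ≥0∞) :
    expect (p.bind q) f = expect p fun a => expect (q a) f := by
  simp only [expect, PMF.bind_apply, ← ENNReal.tsum_mul_right, ← ENNReal.tsum_mul_left]
  rw [ENNReal.tsum_comm]
  simp only [mul_assoc]

theorem expect_pure (a : α) (f : α → ℝ≥0∞) : expect (PMF.pure a) f = f a := by
  rw [expect, tsum_eq_single a]
  · simp
  · intro b hb
    simp [hb]

theorem expect_map (p : PMF α) (g : α → β) (f : β → ℝ≥0∞) :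
    expect (p.map g) f = expect p fun a => f (g a) := by
  rw [← PMF.bind_pure_comp, expect_bind]
  simp [expect_pure]

theorem expect_const (p : PMF α) (c : ℝ≥0∞) : expect p (fun _ => c) = c := by
  rw [expect, ENNReal.tsum_mul_right, p.tsum_coe, one_mul]

theorem expect_add (p : PMF α) (f g : α → ℝ≥0∞) :
    expect p (fun a => f a + g a) = expect p f + expect p g := by
  simp only [expect, mul_add, ENNReal.tsum_add]

theorem expect_mono_support (p : PMF α) {f g : α → ℝ≥0∞} (h : ∀ a ∈ p.support, f a ≤ g a) :
    expect p f ≤ expect p g := by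
  refine ENNReal.tsum_le_tsum fun a => ?_
  by_cases ha : p a = 0
  · simp [ha]
  · gcongr
    exact h a ((p.mem_support_iff a).2 ha)

theorem expect_congr_support (p : PMF α) {f g : α → ℝ≥0∞} (h : ∀ a ∈ p.support, f a = g a) :
    expect p f = expect p g :=
  (expect_mono_support p fun a ha => (h a ha).le).antisymm
    (expect_mono_support p fun a ha => (h a ha).ge)

theorem expect_mono (p : PMF α) {f g : α → ℝ≥0∞} (h : ∀ a, f a ≤ g a) :
    expect p f ≤ expect p g :=
  expect_mono_support p fun a _ => h a

theorem expect_le_of_le (p : PMF α) {f : α → ℝ≥0∞} {c : ℝ≥0∞} (h : ∀ a ∈ p.support, f a ≤ c) :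
    expect p f ≤ c :=
  (expect_mono_support p h).trans_eq (expect_const p c)

theorem expect_le_expect_add (p : PMF α) {f g : α → ℝ≥0∞} {c : ℝ≥0∞}
    (h : ∀ a ∈ p.support, f a ≤ g a + c) : expect p f ≤ expect p g + c :=
  (expect_mono_support p h).trans_eq (by rw [expect_add, expect_const])

theorem expect_comm (p : PMF α) (q : PMF β) (f : α → β → ℝ≥0∞) :
    (expect p fun a => expect q (f a)) = expect q fun b => expect p fun a => f a b := by
  simp only [expect, ← ENNReal.tsum_mul_left]
  rw [ENNReal.tsum_comm]
  simp only [mul_left_comm]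

theorem expect_uniformOfFinset (s : Finset α) (hs : s.Nonempty) (f : α → ℝ≥0∞) :
    expect (PMF.uniformOfFinset s hs) f = (s.card : ℝ≥0∞)⁻¹ * ∑ a ∈ s, f a := by
  rw [expect, tsum_eq_sum (s := s), Finset.mul_sum]
  · exact Finset.sum_congr rfl fun a ha => by rw [PMF.uniformOfFinset_apply_of_mem hs ha]
  · intro a ha
    rw [PMF.uniformOfFinset_apply_of_notMem hs ha, zero_mul]

theorem expect_uniformOfFintype_equiv [Fintype α] [Nonempty α] (e : α ≃ α) (f : α → ℝ≥0∞) :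
    (expect (PMF.uniformOfFintype α) fun a => f (e a)) = expect (PMF.uniformOfFintype α) f := by
  simp only [expect, PMF.uniformOfFintype_apply]
  exact e.tsum_eq fun a => (Fintype.card α : ℝ≥0∞)⁻¹ * f a

theorem uniformOfFintype_map_equiv [Fintype α] [Nonempty α] (e : α ≃ α) :
    (PMF.uniformOfFintype α).map e = PMF.uniformOfFintype α := by
  classical
  ext a
  rw [PMF.map_apply, tsum_eq_single (e.symm a)]
  · simp
  · intro b hb
    rw [if_neg]
    rintro rfl
    simp at hb

theorem lintegral_toMeasure [MeasurableSpace α] [DiscreteMeasurableSpace α] [Countable α]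
    (p : PMF α) (f : α → ℝ≥0∞) : ∫⁻ a, f a ∂p.toMeasure = expect p f := by
  rw [lintegral_countable', expect]
  exact tsum_congr fun a => by
    rw [PMF.toMeasure_apply_singleton _ _ (measurableSet_singleton a), mul_comm]

end Expect

/-! ### Sequences of independent increments -/

section Increments

variable {X : Type*} [MeasurableSpace X]

/-- A finite measure on sequences that is proportional to a product probability measure on all
boxes bearing on an initial segment of the coordinates is proportional to it. -/
theorem eq_smul_infinitePi_nat {ν : ℕ → Measure X} [∀ i, IsProbabilityMeasure (ν i)]
    {ρ : Measure (ℕ → X)} {c : ℝ≥0∞} (hc : c ≠ ∞)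
    (h : ∀ (n : ℕ) (t : ℕ → Set X), (∀ i, MeasurableSet (t i)) →
      ρ {ω | ∀ i < n, ω i ∈ t i} = c * ∏ i ∈ Finset.range n, ν i (t i)) :
    ρ = c • Measure.infinitePi ν := by
  classical
  have huniv : ρ Set.univ = c := by simpa using h 0 (fun _ => Set.univ) fun _ => .univ
  rcases eq_or_ne c 0 with rfl | hc0
  · rw [Measure.measure_univ_eq_zero.1 huniv, zero_smul]
  have key : c⁻¹ • ρ = Measure.infinitePi ν := by
    refine Measure.eq_infinitePi ν fun s t ht => ?_
    obtain ⟨n, hn⟩ : ∃ n, s ⊆ Finset.range n := s.exists_nat_subset_range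
    have hset : (Set.pi s t : Set (ℕ → X)) =
        {ω | ∀ i < n, ω i ∈ if i ∈ s then t i else Set.univ} := by
      ext ω
      refine ⟨fun hω i _ => ?_, fun hω i hi => ?_⟩
      · split_ifs with hi
        · exact hω i hi
        · trivial
      · have := hω i (Finset.mem_range.1 (hn hi))
        rwa [if_pos (Finset.mem_coe.1 hi)] at this
    rw [Measure.smul_apply, hset, h, smul_eq_mul, ← mul_assoc, ENNReal.inv_mul_cancel hc0 hc,
      one_mul, ← Finset.prod_subset hn]
    · exact Finset.prod_congr rfl fun i hi => by rw [if_pos hi]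
    · intro i _ hi
      rw [if_neg hi, measure_univ]
    · intro i
      split_ifs
      · exact ht i
      · exact .univ
  rw [← key, smul_smul, ENNReal.mul_inv_cancel hc0 hc, one_smul]

/-- The sequence with first term `a` followed by the terms of `ω`. -/
def consSeq (a : X) (ω : ℕ → X) : ℕ → X
  | 0 => a
  | n + 1 => ω n

theorem measurable_consSeq : Measurable fun p : X × (ℕ → X) => consSeq p.1 p.2 := by
  refine measurable_pi_lambda _ fun n => ?_
  cases n with
  | zero => exact measurable_fst
  | succ n => exact (measurable_pi_apply n).comp measurable_snd

/-- A sequence of i.i.d. variables is one independent variable followed by a copy of the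
sequence. -/
theorem map_consSeq_prod_infinitePi (ν : Measure X) [IsProbabilityMeasure ν] :
    (ν.prod (Measure.infinitePi fun _ : ℕ => ν)).map (fun p => consSeq p.1 p.2) =
      Measure.infinitePi fun _ : ℕ => ν := by
  have : IsProbabilityMeasure ((ν.prod (Measure.infinitePi fun _ : ℕ => ν)).map
    (fun p => consSeq p.1 p.2)) := Measure.isProbabilityMeasure_map measurable_consSeq.aemeasurable
  rw [← one_smul ℝ≥0∞ (Measure.infinitePi fun _ : ℕ => ν)]
  refine eq_smul_infinitePi_nat ENNReal.one_ne_top fun n t ht => ?_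
  cases n with
  | zero => simp
  | succ n =>
    have hm : MeasurableSet {ω : ℕ → X | ∀ i < n + 1, ω i ∈ t i} := by
      simp only [Set.ofPred_forall]
      exact .iInter fun i => .iInter fun _ => measurable_pi_apply i (ht i)
    have hset : (fun p : X × (ℕ → X) => consSeq p.1 p.2) ⁻¹' {ω | ∀ i < n + 1, ω i ∈ t i} =
        t 0 ×ˢ (Set.pi (Finset.range n) fun i => t (i + 1)) := by
      ext ⟨a, ω⟩
      simp only [Set.mem_preimage, Set.mem_ofPred_eq, Set.mem_prod, Set.mem_pi, Finset.coe_range,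
        Set.mem_Iio]
      refine ⟨fun h => ⟨h 0 n.succ_pos, fun i hi => h (i + 1) (by omega)⟩, fun h i hi => ?_⟩
      cases i with
      | zero => exact h.1
      | succ i => exact h.2 i (by omega)
    rw [Measure.map_apply measurable_consSeq hm, hset, one_smul, Measure.prod_prod,
      Measure.infinitePi_pi _ fun i _ => ht (i + 1), Finset.prod_range_succ', mul_comm, one_mul]

theorem lintegral_infinitePi_cons (ν : Measure X) [IsProbabilityMeasure ν]
    {f : (ℕ → X) → ℝ≥0∞} (hf : Measurable f) :
    ∫⁻ ω, f ω ∂(Measure.infinitePi fun _ : ℕ => ν) =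
      ∫⁻ a, ∫⁻ ω, f (consSeq a ω) ∂(Measure.infinitePi fun _ : ℕ => ν) ∂ν := by
  conv_lhs => rw [← map_consSeq_prod_infinitePi ν]
  rw [lintegral_map hf measurable_consSeq,
    lintegral_prod (fun p : X × (ℕ → X) => f (consSeq p.1 p.2))
      (hf.comp measurable_consSeq).aemeasurable]

theorem infinitePi_apply_cons [DiscreteMeasurableSpace X] [Countable X] (p : PMF X)
    {A : Set (ℕ → X)} (hA : MeasurableSet A) :
    (Measure.infinitePi fun _ : ℕ => p.toMeasure) A =
      expect p fun a => (Measure.infinitePi fun _ : ℕ => p.toMeasure) {ω | consSeq a ω ∈ A} := by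
  rw [← lintegral_toMeasure, ← lintegral_indicator_one hA,
    lintegral_infinitePi_cons _ (measurable_one.indicator hA)]
  refine lintegral_congr fun a => ?_
  have ha : MeasurableSet {ω | consSeq a ω ∈ A} :=
    (measurable_consSeq.comp measurable_prodMk_left) hA
  rw [← lintegral_indicator_one ha]
  rfl

end Increments

/-! ### The random walk and shift-invariant events -/

section Walk

variable {G : Type*} [Group G]

theorem walkTrajectory_consSeq_succ (a : G) (ω : ℕ → G) (n : ℕ) :
    walkTrajectory (consSeq a ω) (n + 1) = a * walkTrajectory ω n := by
  induction n with
  | zero => rfl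
  | succ n ih =>
    rw [walkTrajectory, ih, walkTrajectory, mul_assoc]
    rfl

variable {A : Set (ℕ → G)}

theorem mul_walkTrajectory_consSeq_mem_iff (hshift : ∀ x, (fun n => x (n + 1)) ∈ A ↔ x ∈ A)
    (z a : G) (ω : ℕ → G) :
    (fun n => z * walkTrajectory (consSeq a ω) n) ∈ A ↔
      (fun n => z * a * walkTrajectory ω n) ∈ A := by
  rw [← hshift]
  simp only [walkTrajectory_consSeq_succ, mul_assoc]

variable [MeasurableSpace G]

/-- The probability that the trajectory of the walk started at `z` lies in `A`. -/
noncomputable def hitProb (μ : PMF G) (A : Set (ℕ → G)) (z : G) : ℝ≥0∞ :=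
  (Measure.infinitePi fun _ : ℕ => μ.toMeasure) {ω | (fun n => z * walkTrajectory ω n) ∈ A}

theorem hitProb_le_one (μ : PMF G) (A : Set (ℕ → G)) (z : G) : hitProb μ A z ≤ 1 := prob_le_one

/-- The probability that the walk is at `g` at the trajectory index `n`, that is, after `n + 1`
steps. -/
noncomputable def visitProb (θ : PMF G) (n : ℕ) (g : G) : ℝ≥0∞ :=
  (Measure.infinitePi fun _ : ℕ => θ.toMeasure) {ω | walkTrajectory ω n = g}

theorem visitProb_le_one (θ : PMF G) (n : ℕ) (g : G) : visitProb θ n g ≤ 1 := prob_le_one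

variable [DiscreteMeasurableSpace G] [Countable G]

theorem measurableSet_mul_walkTrajectory_mem (hA : MeasurableSet A) (z : G) :
    MeasurableSet {ω : ℕ → G | (fun n => z * walkTrajectory ω n) ∈ A} := by
  have : Measurable fun (ω : ℕ → G) n => z * walkTrajectory ω n :=
    measurable_pi_lambda _ fun n =>
      (Measurable.of_discrete (f := fun g : G => z * g)).comp
        ((measurable_pi_apply n).comp measurable_walkTrajectory)
  exact this hA

theorem walkLaw_eq_hitProb_one (μ : PMF G) (hA : MeasurableSet A) :
    walkLaw μ A = hitProb μ A 1 := by
  rw [walkLaw, Measure.map_apply measurable_walkTrajectory hA, hitProb]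
  simp only [one_mul]
  rfl

/-- The hitting probability of a shift-invariant event is a harmonic function. -/
theorem hitProb_harmonic (μ : PMF G) (hA : MeasurableSet A)
    (hshift : ∀ x, (fun n => x (n + 1)) ∈ A ↔ x ∈ A) (z : G) :
    hitProb μ A z = expect μ fun s => hitProb μ A (z * s) := by
  rw [hitProb, infinitePi_apply_cons μ (measurableSet_mul_walkTrajectory_mem hA z)]
  simp only [hitProb, Set.mem_ofPred_eq, mul_walkTrajectory_consSeq_mem_iff hshift]

/-- If the hitting probability of a shift-invariant event does not depend on the starting point,
then the event is independent of any finite number of increments. -/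
theorem infinitePi_inter_of_hitProb_const (μ : PMF G) (hA : MeasurableSet A)
    (hshift : ∀ x, (fun n => x (n + 1)) ∈ A ↔ x ∈ A) {c : ℝ≥0∞} (hc : ∀ z, hitProb μ A z = c)
    (n : ℕ) (t : ℕ → Set G) (z : G) :
    (Measure.infinitePi fun _ : ℕ => μ.toMeasure)
      ({ω | ∀ i < n, ω i ∈ t i} ∩ {ω | (fun n => z * walkTrajectory ω n) ∈ A}) =
      c * ∏ i ∈ Finset.range n, μ.toMeasure (t i) := by
  classical
  induction n generalizing t z with
  | zero => simpa [hitProb] using hc z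
  | succ n ih =>
    have hm : MeasurableSet {ω : ℕ → G | ∀ i < n + 1, ω i ∈ t i} := by
      simp only [Set.ofPred_forall]
      exact .iInter fun i => .iInter fun _ => measurable_pi_apply i (.of_discrete)
    rw [infinitePi_apply_cons μ (hm.inter (measurableSet_mul_walkTrajectory_mem hA z))]
    have hsplit : ∀ a, (Measure.infinitePi fun _ : ℕ => μ.toMeasure)
        {ω | consSeq a ω ∈ {ω | ∀ i < n + 1, ω i ∈ t i} ∩
          {ω | (fun n => z * walkTrajectory ω n) ∈ A}} =
        (t 0).indicator 1 a * (c * ∏ i ∈ Finset.range n, μ.toMeasure (t (i + 1))) := by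
      intro a
      rw [← ih (fun i => t (i + 1)) (z * a)]
      by_cases ha : a ∈ t 0
      · rw [Set.indicator_of_mem ha, Pi.one_apply, one_mul]
        congr 1
        ext ω
        simp only [Set.mem_ofPred_eq, Set.mem_inter_iff,
          mul_walkTrajectory_consSeq_mem_iff hshift]
        refine and_congr_left fun _ => ⟨fun h i hi => h (i + 1) (by omega), fun h i hi => ?_⟩
        cases i with
        | zero => exact ha
        | succ i => exact h i (by omega)
      · rw [Set.indicator_of_notMem ha, zero_mul]
        refine measure_mono_null (t := ∅) (fun ω hω => ha (hω.1 0 n.succ_pos)) measure_empty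
    simp only [hsplit]
    rw [expect]
    simp only [← mul_assoc]
    rw [ENNReal.tsum_mul_right, ENNReal.tsum_mul_right, Finset.prod_range_succ',
      ← lintegral_indicator_one (μ := μ.toMeasure) (s := t 0) .of_discrete, lintegral_toMeasure]
    simp only [expect]
    ring

/-- Zero-one law: a shift-invariant event whose probability does not depend on the starting point
is independent of itself. -/
theorem hitProb_eq_zero_or_one (μ : PMF G) (hA : MeasurableSet A)
    (hshift : ∀ x, (fun n => x (n + 1)) ∈ A ↔ x ∈ A)
    (hconst : ∀ z w, hitProb μ A z ≤ hitProb μ A w) : hitProb μ A 1 = 0 ∨ hitProb μ A 1 = 1 := by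
  have hc : ∀ z, hitProb μ A z = hitProb μ A 1 := fun z => (hconst z 1).antisymm (hconst 1 z)
  have htop : hitProb μ A 1 ≠ ∞ := ((hitProb_le_one μ A 1).trans_lt ENNReal.one_lt_top).ne
  set E : Set (ℕ → G) := {ω | (fun n => 1 * walkTrajectory ω n) ∈ A} with hE
  have hEm : MeasurableSet E := measurableSet_mul_walkTrajectory_mem hA 1
  have key : (Measure.infinitePi fun _ : ℕ => μ.toMeasure).restrict E =
      hitProb μ A 1 • Measure.infinitePi fun _ : ℕ => μ.toMeasure := by
    refine eq_smul_infinitePi_nat htop fun n t _ => ?_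
    rw [Measure.restrict_apply' hEm]
    exact infinitePi_inter_of_hitProb_const μ hA hshift hc n t 1
  have hsq : hitProb μ A 1 = hitProb μ A 1 * hitProb μ A 1 := by
    have := congrArg (fun ρ => ρ E) key
    simpa only [Measure.restrict_apply_self, Measure.smul_apply, smul_eq_mul, hE, ← hitProb.eq_1]
      using this
  by_cases h0 : hitProb μ A 1 = 0
  · exact .inl h0
  · refine .inr ?_
    have := congrArg (· / hitProb μ A 1) hsq
    simpa only [mul_div_assoc, ENNReal.div_self h0 htop, mul_one] using this.symm

/-- The Poisson boundary is trivial as soon as bounded harmonic functions are constant. -/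
theorem hasTrivialPoissonBoundary_of_liouville (μ : PMF G)
    (hL : ∀ h : G → ℝ≥0∞, (∀ z, h z ≤ 1) → (∀ z, h z = expect μ fun s => h (z * s)) →
      ∀ z w, h z ≤ h w) :
    HasTrivialPoissonBoundary μ := by
  intro B hB
  have hA : MeasurableSet (PoissonBoundary.bnd ⁻¹' B : Set (ℕ → G)) := hB
  have hshift : ∀ x : ℕ → G, (fun n => x (n + 1)) ∈ (PoissonBoundary.bnd ⁻¹' B : Set (ℕ → G)) ↔
      x ∈ (PoissonBoundary.bnd ⁻¹' B : Set (ℕ → G)) := by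
    intro x
    have : PoissonBoundary.bnd (fun n => x (n + 1)) = PoissonBoundary.bnd x :=
      Quotient.sound ⟨0, 1, fun n => by rw [zero_add, add_comm]⟩
    rw [Set.mem_preimage, this, Set.mem_preimage]
  rw [harmonicMeasure, Measure.map_apply PoissonBoundary.measurable_bnd hB,
    walkLaw_eq_hitProb_one μ hA]
  exact hitProb_eq_zero_or_one μ hA hshift
    (hL _ (hitProb_le_one μ _) (hitProb_harmonic μ hA hshift))

theorem measurableSet_walkTrajectory_eq (n : ℕ) (g : G) :
    MeasurableSet {ω : ℕ → G | walkTrajectory ω n = g} :=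
  ((measurable_pi_apply n).comp measurable_walkTrajectory) (measurableSet_singleton g)

theorem visitProb_succ (θ : PMF G) (n : ℕ) (g : G) :
    visitProb θ (n + 1) g = expect θ fun s => visitProb θ n (s⁻¹ * g) := by
  rw [visitProb, infinitePi_apply_cons θ (measurableSet_walkTrajectory_eq _ _)]
  simp only [Set.mem_ofPred_eq, walkTrajectory_consSeq_succ, visitProb, eq_inv_mul_iff_mul_eq]

theorem sum_visitProb_le_one (θ : PMF G) (n : ℕ) (s : Finset G) :
    ∑ g ∈ s, visitProb θ n g ≤ 1 := by
  simp only [visitProb]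
  rw [← measure_biUnion_finset _ fun g _ => measurableSet_walkTrajectory_eq n g]
  · exact prob_le_one
  · intro g _ g' _ hne
    exact Set.disjoint_left.2 fun ω h h' => hne (h.symm.trans h')

theorem isTransientWalk_of_tsum_visitProb (θ : PMF G) (h : ∀ g, ∑' n, visitProb θ n g ≠ ∞) :
    IsTransientWalk θ := by
  rw [IsTransientWalk, ae_all_iff]
  intro g
  refine ae_finite_setOfPred_mem (s := fun n => {x : ℕ → G | x n = g}) ?_
  convert h g using 3 with n
  have hm : MeasurableSet {x : ℕ → G | x n = g} :=
    measurableSet_preimage (f := fun x : ℕ → G => x n) (measurable_pi_apply n)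
      (measurableSet_singleton g)
  rw [walkLaw, Measure.map_apply measurable_walkTrajectory hm]
  rfl

end Walk

/-! ### Balls in the lampshuffler group -/

section Balls

/-- Translations of `ℤ`, as elements of the lampshuffler group. -/
abbrev translation (a : ℤ) : Lampshuffler (Multiplicative ℤ) :=
  SemidirectProduct.inr (Multiplicative.ofAdd a)

/-- The finitary permutations of `ℤ` supported in `[-r, r]`. -/
def boxPerm (r : ℕ) : Subgroup (FSym (Multiplicative ℤ)) where
  carrier := {f | ∀ x : Multiplicative ℤ, (r : ℤ) < |x.toAdd| →
    (f : Equiv.Perm (Multiplicative ℤ)) x = x}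
  one_mem' := fun _ _ => rfl
  mul_mem' := by
    intro f g hf hg x hx
    rw [Subgroup.coe_mul, Equiv.Perm.mul_apply, hg x hx, hf x hx]
  inv_mem' := by
    intro f hf x hx
    rw [Subgroup.coe_inv, Equiv.Perm.inv_eq_iff_eq, hf x hx]

theorem boxPerm_mono {r s : ℕ} (h : r ≤ s) : boxPerm r ≤ boxPerm s :=
  fun _ hf x hx => hf x (by omega)

theorem exists_mem_boxPerm (f : FSym (Multiplicative ℤ)) : ∃ r, f ∈ boxPerm r := by
  obtain ⟨r, hr⟩ := ((mem_FSym.1 f.2).image fun x => x.toAdd.natAbs).bddAbove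
  refine ⟨r, fun x hx => ?_⟩
  by_contra hne
  have := hr ⟨x, hne, rfl⟩
  rw [Int.abs_eq_natAbs] at hx
  simp only at this
  omega

instance boxPerm.finite (r : ℕ) : Finite (boxPerm r) := by
  classical
  let p : Multiplicative ℤ → Prop := fun x => |x.toAdd| ≤ (r : ℤ)
  have hp : Finite (Subtype p) := by
    refine Set.Finite.to_subtype (s := {x | p x}) ?_
    refine Set.Finite.of_finite_image (f := Multiplicative.toAdd)
      ((Set.finite_Icc (-r : ℤ) r).subset ?_) Multiplicative.toAdd.injective.injOn
    rintro _ ⟨x, hx, rfl⟩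
    exact abs_le.1 hx
  have hfin : Finite {f : Equiv.Perm (Multiplicative ℤ) // ∀ a, ¬p a → f a = a} :=
    Finite.of_equiv _ (Equiv.Perm.subtypeEquivSubtypePerm p)
  refine Finite.of_injective (β := {f : Equiv.Perm (Multiplicative ℤ) // ∀ a, ¬p a → f a = a})
    (fun f => ⟨f.1.1, fun a ha => f.2 a (not_le.1 ha)⟩) fun f g hfg => ?_
  exact Subtype.ext (Subtype.ext (Subtype.mk.inj hfg))

noncomputable instance boxPerm.fintype (r : ℕ) : Fintype (boxPerm r) := Fintype.ofFinite _

theorem action_mem_boxPerm {r s : ℕ} {f : FSym (Multiplicative ℤ)} (hf : f ∈ boxPerm r)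
    (a : Multiplicative ℤ) (h : r + |a.toAdd| ≤ s) : FSym.action _ a f ∈ boxPerm s := by
  intro x hx
  have h1 : (r : ℤ) < |(a⁻¹ * x).toAdd| := by
    rw [toAdd_mul, toAdd_inv]
    have := abs_sub_abs_le_abs_sub x.toAdd a.toAdd
    rw [neg_add_eq_sub]
    omega
  rw [FSym.action_apply, hf _ h1, mul_inv_cancel_left]

/-- The elements `(σ, a)` with `|a| ≤ r` and `σ` supported in `[-r, r]`. -/
def ball (r : ℕ) : Set (Lampshuffler (Multiplicative ℤ)) :=
  {z | |z.right.toAdd| ≤ r ∧ z.left ∈ boxPerm r}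

theorem ball_mono {r s : ℕ} (h : r ≤ s) : ball r ⊆ ball s :=
  fun _ hz => ⟨hz.1.trans (by exact_mod_cast h), boxPerm_mono h hz.2⟩

theorem exists_mem_ball (z : Lampshuffler (Multiplicative ℤ)) : ∃ r, z ∈ ball r := by
  obtain ⟨r, hr⟩ := exists_mem_boxPerm z.left
  refine ⟨r + z.right.toAdd.natAbs, ?_, boxPerm_mono (by omega) hr⟩
  push_cast
  exact le_add_of_nonneg_left r.cast_nonneg

theorem mul_mem_ball {r s : ℕ} {z w : Lampshuffler (Multiplicative ℤ)} (hz : z ∈ ball r)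
    (hw : w ∈ ball s) : z * w ∈ ball (r + s) := by
  have hz1 := hz.1
  constructor
  · rw [SemidirectProduct.mul_right, toAdd_mul, Nat.cast_add]
    exact (abs_add_le _ _).trans (add_le_add hz.1 hw.1)
  · rw [SemidirectProduct.mul_left]
    refine mul_mem (boxPerm_mono (by omega) hz.2) (action_mem_boxPerm hw.2 _ ?_)
    push_cast
    omega

theorem translation_mem_ball {r : ℕ} {a : ℤ} (h : |a| ≤ r) : translation a ∈ ball r :=
  ⟨h, one_mem _⟩

theorem inl_mem_ball {r : ℕ} {σ : FSym (Multiplicative ℤ)} (h : σ ∈ boxPerm r) :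
    SemidirectProduct.inl σ ∈ ball r :=
  ⟨by simp, h⟩

end Balls

/-! ### The almost invariant step laws -/

section StepLaw

/-- The uniform law on the integers of `[0, N)`. -/
noncomputable def intervalLaw (N : ℕ) [NeZero N] : PMF ℤ :=
  PMF.uniformOfFinset (Finset.Ico (0 : ℤ) N)
    (Finset.nonempty_Ico.2 (by exact_mod_cast Nat.pos_of_neZero N))

/-- The law of `t ^ m * σ * t ^ (-m')`, where `t` is the unit translation, `m` and `m'` are uniform
in `[0, N)`, `σ` is a uniform permutation supported in `[-3N, 3N]`, and all three are
independent. -/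
noncomputable def stepLaw (N : ℕ) [NeZero N] : PMF (Lampshuffler (Multiplicative ℤ)) :=
  (intervalLaw N).bind fun m => (PMF.uniformOfFintype (boxPerm (3 * N))).bind fun σ =>
    (intervalLaw N).bind fun m' =>
      PMF.pure (translation m * SemidirectProduct.inl σ.1 * (translation m')⁻¹)

variable (N : ℕ) [NeZero N]

theorem mem_support_intervalLaw {m : ℤ} : m ∈ (intervalLaw N).support ↔ 0 ≤ m ∧ m < N := by
  rw [intervalLaw, PMF.mem_support_uniformOfFinset_iff, Finset.mem_Ico]

theorem expect_intervalLaw (f : ℤ → ℝ≥0∞) :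
    expect (intervalLaw N) f = (N : ℝ≥0∞)⁻¹ * ∑ m ∈ Finset.Ico (0 : ℤ) N, f m := by
  rw [intervalLaw, expect_uniformOfFinset, Int.card_Ico, sub_zero, Int.toNat_natCast]

theorem expect_stepLaw (f : Lampshuffler (Multiplicative ℤ) → ℝ≥0∞) :
    expect (stepLaw N) f = expect (intervalLaw N) fun m =>
      expect (PMF.uniformOfFintype (boxPerm (3 * N))) fun σ => expect (intervalLaw N) fun m' =>
        f (translation m * SemidirectProduct.inl σ.1 * (translation m')⁻¹) := by
  simp only [stepLaw, expect_bind, expect_pure]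

theorem mem_support_stepLaw {z : Lampshuffler (Multiplicative ℤ)} :
    z ∈ (stepLaw N).support ↔ ∃ m ∈ (intervalLaw N).support, ∃ σ ∈ boxPerm (3 * N),
      ∃ m' ∈ (intervalLaw N).support,
        z = translation m * SemidirectProduct.inl σ * (translation m')⁻¹ := by
  simp only [stepLaw, PMF.mem_support_bind_iff, PMF.mem_support_pure_iff,
    PMF.support_uniformOfFintype, Set.mem_univ, true_and, Subtype.exists, Set.top_eq_univ]
  simp only [exists_prop]

theorem mem_ball_of_mem_support_stepLaw {z : Lampshuffler (Multiplicative ℤ)}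
    (hz : z ∈ (stepLaw N).support) : z ∈ ball (5 * N) := by
  obtain ⟨m, hm, σ, hσ, m', hm', rfl⟩ := (mem_support_stepLaw N).1 hz
  rw [mem_support_intervalLaw] at hm hm'
  have h1 : translation m ∈ ball N := translation_mem_ball (by rw [abs_le]; omega)
  have h2 : (translation m')⁻¹ ∈ ball N := by
    rw [← map_inv, ← ofAdd_neg]
    exact translation_mem_ball (by rw [abs_le]; omega)
  exact ball_mono (by omega) (mul_mem_ball (mul_mem_ball h1 (inl_mem_ball hσ)) h2)

theorem ball_subset_support_stepLaw {r : ℕ} (h : r < N) : ball r ⊆ (stepLaw N).support := by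
  intro z hz
  have habs := abs_le.1 hz.1
  rw [mem_support_stepLaw]
  rcases le_total 0 z.right.toAdd with hpos | hneg
  · refine ⟨z.right.toAdd, (mem_support_intervalLaw N).2 ⟨hpos, by omega⟩,
      FSym.action _ z.right⁻¹ z.left, action_mem_boxPerm hz.2 _ ?_, 0,
      (mem_support_intervalLaw N).2 ⟨le_rfl, by omega⟩, ?_⟩
    · rw [toAdd_inv, abs_neg]
      have := hz.1
      push_cast
      omega
    · ext1 <;> simp [SemidirectProduct.mul_left]
  · refine ⟨0, (mem_support_intervalLaw N).2 ⟨le_rfl, by omega⟩, z.left,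
      boxPerm_mono (by omega) hz.2, -z.right.toAdd,
      (mem_support_intervalLaw N).2 ⟨by omega, by omega⟩, ?_⟩
    ext1 <;> simp [SemidirectProduct.mul_left]

theorem stepLaw_map_inv : (stepLaw N).map (fun z => z⁻¹) = stepLaw N := by
  have hsymm : (PMF.uniformOfFintype (boxPerm (3 * N))).map (Equiv.inv _) =
      PMF.uniformOfFintype (boxPerm (3 * N)) := uniformOfFintype_map_equiv _
  -- Inversion swaps `m` and `m'` and replaces `σ` by its inverse.
  have key : (stepLaw N).map (fun z => z⁻¹) = (intervalLaw N).bind fun m =>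
      (PMF.uniformOfFintype (boxPerm (3 * N))).bind fun σ => (intervalLaw N).bind fun m' =>
        PMF.pure (translation m' * SemidirectProduct.inl (σ⁻¹).1 * (translation m)⁻¹) := by
    simp only [stepLaw, PMF.map_bind, PMF.pure_map, mul_inv_rev, inv_inv, mul_assoc,
      Subgroup.coe_inv, map_inv]
  have hσ : ∀ m : ℤ, ((PMF.uniformOfFintype (boxPerm (3 * N))).bind fun σ =>
      (intervalLaw N).bind fun m' =>
        PMF.pure (translation m' * SemidirectProduct.inl (σ⁻¹).1 * (translation m)⁻¹)) =
      (PMF.uniformOfFintype (boxPerm (3 * N))).bind fun σ => (intervalLaw N).bind fun m' =>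
        PMF.pure (translation m' * SemidirectProduct.inl σ.1 * (translation m)⁻¹) := by
    intro m
    conv_rhs => rw [← hsymm, PMF.bind_map]
    rfl
  rw [key]
  simp only [hσ]
  rw [stepLaw]
  simp only [PMF.bind_comm (PMF.uniformOfFintype (boxPerm (3 * N))) (intervalLaw N)]
  rw [PMF.bind_comm]

/-- Averages over two translates of `[0, N)` differ by at most the length of the translation
over `N`. -/
theorem expect_intervalLaw_translate_le {f : ℤ → ℝ≥0∞} (hf : ∀ i, f i ≤ 1) {a b : ℤ} {d : ℕ}
    (h : |a - b| ≤ d) :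
    (expect (intervalLaw N) fun m => f (a + m)) ≤
      (expect (intervalLaw N) fun m => f (b + m)) + d / N := by
  have himage : ∀ c : ℤ, ∑ m ∈ Finset.Ico (0 : ℤ) N, f (c + m) =
      ∑ m ∈ Finset.Ico c (c + N), f m := by
    intro c
    simpa only [add_comm, add_zero] using Finset.sum_Ico_add' f 0 (N : ℤ) c
  rw [expect_intervalLaw, expect_intervalLaw, himage, himage, ENNReal.div_eq_inv_mul, ← mul_add]
  gcongr
  have hcard : (Finset.Ico a (a + N) \ Finset.Ico b (b + N)).card ≤ d := by
    have hsub : Finset.Ico a (a + N) \ Finset.Ico b (b + N) ⊆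
        if a ≤ b then Finset.Ico a b else Finset.Ico (b + N) (a + N) := by
      intro m hm
      simp only [Finset.mem_sdiff, Finset.mem_Ico] at hm
      split_ifs <;> rw [Finset.mem_Ico] <;> omega
    refine (Finset.card_le_card hsub).trans ?_
    have := abs_le.1 h
    split_ifs <;> rw [Int.card_Ico] <;> omega
  calc ∑ m ∈ Finset.Ico a (a + N), f m
      ≤ ∑ m ∈ Finset.Ico b (b + N) ∪ (Finset.Ico a (a + N) \ Finset.Ico b (b + N)), f m := by
        refine Finset.sum_le_sum_of_subset ?_
        rw [Finset.union_sdiff_self_eq_union]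
        exact Finset.subset_union_right
    _ = ∑ m ∈ Finset.Ico b (b + N), f m +
        ∑ m ∈ Finset.Ico a (a + N) \ Finset.Ico b (b + N), f m :=
        Finset.sum_union Finset.disjoint_sdiff
    _ ≤ ∑ m ∈ Finset.Ico b (b + N), f m + d := by
        gcongr
        refine (Finset.sum_le_card_nsmul _ _ 1 fun m _ => hf m).trans ?_
        rw [nsmul_one]
        exact_mod_cast hcard

/-- Left translation by `(τ, a)` in the ball of radius `r ≤ N` acts on the step law as the
translation of `m` by `a`: conjugating `τ` past the translations gives a permutation
supported in `[-3N, 3N]`, which the uniform permutation absorbs. -/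
theorem expect_stepLaw_mul_left (f : Lampshuffler (Multiplicative ℤ) → ℝ≥0∞) {r : ℕ} (hr : r ≤ N)
    {z : Lampshuffler (Multiplicative ℤ)} (hz : z ∈ ball r) :
    (expect (stepLaw N) fun s => f (z * s)) = expect (intervalLaw N) fun m =>
      expect (PMF.uniformOfFintype (boxPerm (3 * N))) fun σ => expect (intervalLaw N) fun m' =>
        f (translation (z.right.toAdd + m) * SemidirectProduct.inl σ.1 * (translation m')⁻¹) := by
  rw [expect_stepLaw]
  refine expect_congr_support _ fun m hm => ?_
  rw [mem_support_intervalLaw] at hm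
  have habs := abs_le.1 hz.1
  set b : Multiplicative ℤ := Multiplicative.ofAdd (z.right.toAdd + m) with hb
  -- `τ * t ^ (a + m) = t ^ (a + m) * τ'` with `τ'` the following conjugate of `τ`.
  have hτ : FSym.action _ b⁻¹ z.left ∈ boxPerm (3 * N) := by
    refine action_mem_boxPerm hz.2 _ ?_
    rw [toAdd_inv, abs_neg, hb, toAdd_ofAdd]
    have : |z.right.toAdd + m| ≤ r + N := by rw [abs_le]; omega
    push_cast
    omega
  have hmul : ∀ σ : boxPerm (3 * N), z * translation m * SemidirectProduct.inl σ.1 =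
      translation (z.right.toAdd + m) *
        SemidirectProduct.inl (Equiv.mulLeft (⟨_, hτ⟩ : boxPerm (3 * N)) σ).1 := by
    intro σ
    ext1 <;> simp [SemidirectProduct.mul_left, hb]
  rw [← expect_uniformOfFintype_equiv (Equiv.mulLeft (⟨_, hτ⟩ : boxPerm (3 * N)))
    fun σ => expect (intervalLaw N) fun m' =>
      f (translation (z.right.toAdd + m) * SemidirectProduct.inl σ.1 * (translation m')⁻¹)]
  simp only [← hmul, mul_assoc]

theorem expect_stepLaw_le {h : Lampshuffler (Multiplicative ℤ) → ℝ≥0∞} (hh : ∀ z, h z ≤ 1)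
    {r : ℕ} (hr : r ≤ N) {z w : Lampshuffler (Multiplicative ℤ)} (hz : z ∈ ball r)
    (hw : w ∈ ball r) :
    (expect (stepLaw N) fun s => h (z * s)) ≤
      (expect (stepLaw N) fun s => h (w * s)) + (2 * r : ℕ) / N := by
  rw [expect_stepLaw_mul_left N h hr hz, expect_stepLaw_mul_left N h hr hw]
  refine expect_intervalLaw_translate_le N
    (f := fun i => expect (PMF.uniformOfFintype (boxPerm (3 * N))) fun σ =>
      expect (intervalLaw N) fun m' =>
        h (translation i * SemidirectProduct.inl σ.1 * (translation m')⁻¹))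
    (fun i => expect_le_of_le _ fun σ _ => expect_le_of_le _ fun m' _ => hh _) ?_
  have h1 := abs_le.1 hz.1
  have h2 := abs_le.1 hw.1
  rw [abs_le]
  push_cast
  omega

/-- The step law makes the walk on `ℤ` spread out: no integer has probability more than `1 / N`
after a step, whatever the law of the position is. -/
theorem expect_stepLaw_translate_le {v : Multiplicative ℤ → ℝ≥0∞}
    (hv : ∀ s : Finset (Multiplicative ℤ), ∑ y ∈ s, v y ≤ 1) (y : Multiplicative ℤ) :
    (expect (stepLaw N) fun s => v (s.right⁻¹ * y)) ≤ (N : ℝ≥0∞)⁻¹ := by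
  have hright : ∀ (m m' : ℤ) (σ : FSym (Multiplicative ℤ)),
      (translation m * SemidirectProduct.inl σ * (translation m')⁻¹).right⁻¹ * y =
        Multiplicative.ofAdd (m' - m) * y := fun m m' σ => by
    rw [ofAdd_sub]
    simp [div_eq_mul_inv]
  simp only [expect_stepLaw, hright, expect_const]
  rw [expect_comm]
  refine expect_le_of_le _ fun m' _ => ?_
  have hinj : Set.InjOn (fun m : ℤ => Multiplicative.ofAdd (m' - m) * y)
      (Finset.Ico (0 : ℤ) N) := fun m _ n _ hmn => by simpa using hmn
  rw [expect_intervalLaw, ← Finset.sum_image hinj]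
  exact (mul_le_mul_right (hv _) _).trans_eq (mul_one _)

end StepLaw

/-! ### The random scale -/

section Scale

open Filter Topology

/-- The law of the index of the scale: `k` has probability `2 ^ (-(k + 1))`. -/
noncomputable def indexLaw : PMF ℕ :=
  ⟨fun k => 2⁻¹ ^ (k + 1), by
    rw [ENNReal.summable.hasSum_iff, ENNReal.tsum_geometric_add_one, ENNReal.one_sub_inv_two,
      inv_inv, ENNReal.inv_mul_cancel two_ne_zero ENNReal.ofNat_ne_top]⟩

theorem indexLaw_apply (k : ℕ) : indexLaw k = 2⁻¹ ^ (k + 1) := rfl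

/-- The probability that the index of the scale is at most `M`. -/
noncomputable def lowProb (M : ℕ) : ℝ≥0∞ := 1 - 2⁻¹ ^ (M + 1)

theorem lowProb_add (M : ℕ) : lowProb M + 2⁻¹ ^ (M + 1) = 1 :=
  tsub_add_cancel_of_le (pow_le_one₀ zero_le (by simp))

theorem expect_indexLaw_le (M : ℕ) {f : ℕ → ℝ≥0∞} {D δ : ℝ≥0∞} (hD : ∀ k ≤ M, f k ≤ D)
    (hδ : ∀ k, M < k → f k ≤ δ) :
    expect indexLaw f ≤ lowProb M * D + 2⁻¹ ^ (M + 1) * δ := by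
  have htail : ∑' k, indexLaw (k + (M + 1)) = 2⁻¹ ^ (M + 1) := by
    have : ∀ k, indexLaw (k + (M + 1)) = indexLaw k * 2⁻¹ ^ (M + 1) := fun k => by
      rw [indexLaw_apply, indexLaw_apply, ← pow_add]
      congr 1
      omega
    simp only [this]
    rw [ENNReal.tsum_mul_right, indexLaw.tsum_coe, one_mul]
  have hhead : ∑ k ∈ Finset.range (M + 1), indexLaw k = lowProb M := by
    have hsum := Summable.sum_add_tsum_nat_add' (f := indexLaw) (k := M + 1) ENNReal.summable
    rw [htail, indexLaw.tsum_coe] at hsum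
    exact ENNReal.eq_sub_of_add_eq (ENNReal.pow_ne_top (by simp)) hsum
  have hsplit := Summable.sum_add_tsum_nat_add' (f := fun k => indexLaw k * f k) (k := M + 1)
    ENNReal.summable
  rw [expect, ← hsplit, ← hhead, Finset.sum_mul]
  refine add_le_add (Finset.sum_le_sum fun k hk => ?_) ?_
  · gcongr
    exact hD k (Nat.lt_succ_iff.1 (Finset.mem_range.1 hk))
  · rw [← htail, ← ENNReal.tsum_mul_right]
    refine ENNReal.tsum_le_tsum fun k => ?_
    gcongr
    exact hδ _ (by omega)

/-- One step of the recursions bounding oscillations and concentrations. -/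
theorem lowProb_mul_add (M i : ℕ) (δ : ℝ≥0∞) :
    lowProb M * (lowProb M ^ i + δ) + 2⁻¹ ^ (M + 1) * δ = lowProb M ^ (i + 1) + δ := by
  rw [mul_add, add_assoc, ← add_mul, lowProb_add, one_mul, pow_succ']

/-- The probability that the indices of `n` independent scales are all at most `M` is small once
`n` is larger than `2 ^ M`: by `(1 - x) ^ n ≤ exp (-n x) ≤ 2 / (n x) ^ 2` with
`x = 2 ^ (-(M + 1))`. -/
theorem lowProb_pow_le (M : ℕ) {n : ℕ} (hn : 0 < n) :
    lowProb M ^ n ≤ ENNReal.ofReal (8 * 4 ^ M / n ^ 2) := by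
  have hx : lowProb M = ENNReal.ofReal (1 - (2⁻¹ : ℝ) ^ (M + 1)) := by
    rw [ENNReal.ofReal_sub _ (by positivity), ENNReal.ofReal_one,
      ENNReal.ofReal_pow (by positivity), ENNReal.ofReal_inv_of_pos two_pos, ENNReal.ofReal_ofNat, lowProb]
  have hx1 : (2⁻¹ : ℝ) ^ (M + 1) ≤ 1 := pow_le_one₀ (by norm_num) (by norm_num)
  rw [hx, ← ENNReal.ofReal_pow (by linarith)]
  refine ENNReal.ofReal_le_ofReal ?_
  set x : ℝ := (2⁻¹ : ℝ) ^ (M + 1) with hxdef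
  have hxpos : 0 < x := by positivity
  have hnpos : (0 : ℝ) < n := by exact_mod_cast hn
  have h1 : (1 - x) ^ n ≤ Real.exp (-(n * x)) := by
    rw [← mul_neg, Real.exp_nat_mul]
    exact pow_le_pow_left₀ (by linarith) (Real.one_sub_le_exp_neg x) n
  have h2 : (n * x) ^ 2 / 2 ≤ Real.exp (n * x) := by
    have := Real.quadratic_le_exp_of_nonneg (x := n * x) (by positivity)
    nlinarith [mul_pos hnpos hxpos]
  have h3 : x ^ 2 * (4 * 4 ^ M) = 1 := by
    rw [hxdef, ← pow_succ', ← pow_mul, mul_comm (M + 1) 2, pow_mul, ← mul_pow]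
    norm_num
  calc (1 - x) ^ n ≤ Real.exp (-(n * x)) := h1
    _ = (Real.exp (n * x))⁻¹ := Real.exp_neg _
    _ ≤ ((n * x) ^ 2 / 2)⁻¹ := inv_anti₀ (by positivity) h2
    _ = 8 * 4 ^ M / n ^ 2 := by
      have : x ≠ 0 := hxpos.ne'
      field_simp
      linarith

/-- The scales `N_k = 256 ^ (k ^ 2)`. Their growth is such that `4 ^ M` steps at scales up to
`N_M` stay far below `N_{M + 1}`. -/
def scale (k : ℕ) : ℕ := 256 ^ k ^ 2

instance (k : ℕ) : NeZero (scale k) := ⟨by unfold scale; positivity⟩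

theorem scale_mono {j k : ℕ} (h : j ≤ k) : scale j ≤ scale k := by
  unfold scale
  gcongr
  norm_num

theorem scale_succ (M : ℕ) : scale (M + 1) = scale M * (256 * 256 ^ (2 * M)) := by
  rw [scale, scale, ← pow_succ', ← pow_add]
  congr 1
  ring

theorem lt_scale_succ (r : ℕ) : r < scale (r + 1) := by
  refine (Nat.lt_pow_self (by norm_num : 1 < 256)).trans_le ?_
  exact Nat.pow_le_pow_right (by norm_num) (by nlinarith)

theorem radius_mul_le_scale_succ {r M : ℕ} (h : r ≤ M) :
    (r + 4 ^ M * (5 * scale M)) * 4 ^ M ≤ scale (M + 1) := by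
  have hN : 1 ≤ scale M := Nat.pos_of_neZero _
  have hM : r ≤ 4 ^ M := h.trans (Nat.lt_pow_self (by norm_num)).le
  have h16 : 4 ^ M * 4 ^ M ≤ 256 ^ (2 * M) := by
    rw [← mul_pow, pow_mul]
    gcongr
    norm_num
  calc (r + 4 ^ M * (5 * scale M)) * 4 ^ M ≤ (4 ^ M * scale M + 4 ^ M * (5 * scale M)) * 4 ^ M := by
        gcongr
        nlinarith
    _ = scale M * (6 * (4 ^ M * 4 ^ M)) := by ring
    _ ≤ scale M * (256 * 256 ^ (2 * M)) := by
        gcongr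
        norm_num
    _ = scale (M + 1) := (scale_succ M).symm

end Scale

/-! ### The random walk with a random scale -/

section ScaleMixture

open Filter Topology

/-- The mixture of the step laws at the scales `N_k`, with weights `2 ^ (-(k + 1))`. -/
noncomputable def mixtureLaw : PMF (Lampshuffler (Multiplicative ℤ)) :=
  indexLaw.bind fun k => stepLaw (scale k)

theorem expect_mixtureLaw (f : Lampshuffler (Multiplicative ℤ) → ℝ≥0∞) :
    expect mixtureLaw f = expect indexLaw fun k => expect (stepLaw (scale k)) f :=
  expect_bind _ _ _

theorem support_mixtureLaw : mixtureLaw.support = Set.univ := by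
  refine Set.eq_univ_of_forall fun z => ?_
  obtain ⟨r, hr⟩ := exists_mem_ball z
  refine (PMF.mem_support_bind_iff _ _ _).2 ⟨r + 1, ?_, ?_⟩
  · rw [PMF.mem_support_iff, indexLaw_apply]
    simp
  · exact ball_subset_support_stepLaw _ (lt_scale_succ r) hr

theorem isNonDegenerateLaw_mixtureLaw : IsNonDegenerateLaw mixtureLaw := by
  rw [IsNonDegenerateLaw, support_mixtureLaw, Subsemigroup.closure_univ]

theorem isSymmetricLaw_mixtureLaw : IsSymmetricLaw mixtureLaw := by
  classical
  intro g
  have hmap : mixtureLaw.map (fun z => z⁻¹) = mixtureLaw := by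
    simp only [mixtureLaw, PMF.map_bind, stepLaw_map_inv]
  conv_rhs => rw [← hmap]
  rw [PMF.map_apply, tsum_eq_single g⁻¹]
  · simp
  · intro b hb
    rw [if_neg]
    rintro rfl
    simp at hb

variable {h : Lampshuffler (Multiplicative ℤ) → ℝ≥0∞}

/-- The oscillation of a harmonic function on a ball: a step at scale at most `N_M` leads to a
slightly larger ball, where the same bound holds by induction with `i - 1`, while a step at a
larger scale forgets the starting point up to the error `2R / N_{M + 1}`. -/
theorem harmonic_le_add_on_ball (hh : ∀ z, h z ≤ 1)
    (hharm : ∀ z, h z = expect mixtureLaw fun s => h (z * s)) {M R : ℕ} (hR : R ≤ scale (M + 1))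
    (i r : ℕ) (hr : r + i * (5 * scale M) ≤ R) {z w : Lampshuffler (Multiplicative ℤ)}
    (hz : z ∈ ball r) (hw : w ∈ ball r) :
    h z ≤ h w + (lowProb M ^ i + (2 * R : ℕ) / scale (M + 1)) := by
  induction i generalizing r z w with
  | zero =>
    rw [pow_zero]
    exact (hh z).trans (le_add_left le_self_add)
  | succ i ih =>
    set D : ℝ≥0∞ := lowProb M ^ i + (2 * R : ℕ) / scale (M + 1) with hD
    have hstep : ∀ k, (expect (stepLaw (scale k)) fun s => h (z * s)) ≤
        (expect (stepLaw (scale k)) fun s => h (w * s)) +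
          if k ≤ M then D else (2 * R : ℕ) / scale (M + 1) := by
      intro k
      split_ifs with hk
      · refine expect_le_expect_add _ fun s hs => ih (r + 5 * scale M) (by linarith) ?_ ?_
        all_goals
          refine mul_mem_ball ‹_› (ball_mono ?_ (mem_ball_of_mem_support_stepLaw _ hs))
          exact Nat.mul_le_mul_left 5 (scale_mono hk)
      · have hkM : scale (M + 1) ≤ scale k := scale_mono (by omega)
        have hrR : r ≤ R := le_trans (Nat.le_add_right _ _) hr
        refine (expect_stepLaw_le (scale k) hh (hR.trans hkM) (ball_mono hrR hz)
          (ball_mono hrR hw)).trans ?_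
        gcongr
    calc h z = expect indexLaw fun k => expect (stepLaw (scale k)) fun s => h (z * s) := by
          rw [hharm z, expect_mixtureLaw]
      _ ≤ expect indexLaw fun k => (expect (stepLaw (scale k)) fun s => h (w * s)) +
            if k ≤ M then D else (2 * R : ℕ) / scale (M + 1) := expect_mono _ hstep
      _ = h w + expect indexLaw fun k => if k ≤ M then D else (2 * R : ℕ) / scale (M + 1) := by
          rw [expect_add, ← expect_mixtureLaw fun s => h (w * s), ← hharm w]
      _ ≤ h w + (lowProb M * D + 2⁻¹ ^ (M + 1) * ((2 * R : ℕ) / scale (M + 1))) := by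
          gcongr
          exact expect_indexLaw_le M (fun k hk => by rw [if_pos hk])
            fun k hk => by rw [if_neg (by omega)]
      _ = h w + (lowProb M ^ (i + 1) + (2 * R : ℕ) / scale (M + 1)) := by
          rw [hD, lowProb_mul_add]

/-- Liouville property: harmonic functions with values in `[0, 1]` are constant. -/
theorem harmonic_le (hh : ∀ z, h z ≤ 1)
    (hharm : ∀ z, h z = expect mixtureLaw fun s => h (z * s))
    (z w : Lampshuffler (Multiplicative ℤ)) : h z ≤ h w := by
  obtain ⟨r₁, hz⟩ := exists_mem_ball z
  obtain ⟨r₂, hw⟩ := exists_mem_ball w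
  set r := r₁ + r₂
  have hbound : ∀ M, r ≤ M → h z ≤ h w + ENNReal.ofReal (10 * (4⁻¹ : ℝ) ^ M) := by
    intro M hM
    have hR := radius_mul_le_scale_succ hM
    set R := r + 4 ^ M * (5 * scale M) with hRdef
    have h4 : 1 ≤ 4 ^ M := Nat.one_le_pow _ _ (by norm_num)
    refine (harmonic_le_add_on_ball hh hharm (R := R) (by nlinarith) (4 ^ M) r le_rfl
      (ball_mono (by omega) hz) (ball_mono (by omega) hw)).trans ?_
    gcongr
    have hδ : ((2 * R : ℕ) : ℝ≥0∞) / scale (M + 1) ≤ ENNReal.ofReal (2 * (4⁻¹ : ℝ) ^ M) := by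
      have hpos : (0 : ℝ) < scale (M + 1) := by exact_mod_cast Nat.pos_of_neZero (scale (M + 1))
      rw [← ENNReal.ofReal_natCast, ← ENNReal.ofReal_natCast, ← ENNReal.ofReal_div_of_pos hpos]
      refine ENNReal.ofReal_le_ofReal ?_
      rw [div_le_iff₀ hpos, inv_pow, mul_assoc, inv_mul_eq_div]
      push_cast
      gcongr
      rw [le_div_iff₀ (by positivity)]
      exact_mod_cast hR
    refine (add_le_add (lowProb_pow_le M h4) hδ).trans_eq ?_
    rw [← ENNReal.ofReal_add (by positivity) (by positivity)]
    congr 1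
    push_cast
    rw [inv_pow]
    field_simp
    norm_num
  have hlim : Tendsto (fun M : ℕ => h w + ENNReal.ofReal (10 * (4⁻¹ : ℝ) ^ M)) atTop
      (𝓝 (h w + ENNReal.ofReal (10 * 0))) := by
    refine tendsto_const_nhds.add (ENNReal.tendsto_ofReal (Tendsto.const_mul _ ?_))
    exact tendsto_pow_atTop_nhds_zero_of_lt_one (by norm_num) (by norm_num)
  rw [mul_zero, ENNReal.ofReal_zero, add_zero] at hlim
  exact ge_of_tendsto hlim (eventually_atTop.2 ⟨r, hbound⟩)

/-- The step distribution of the projection of the walk to `ℤ`. -/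
noncomputable def projectedLaw : PMF (Multiplicative ℤ) :=
  mixtureLaw.map
    (SemidirectProduct.rightHom : Lampshuffler (Multiplicative ℤ) →* Multiplicative ℤ)

/-- Concentration of the projected walk: either all the steps but the last have scales at most
`N_M`, or a step at a larger scale has spread the walk over an interval of length `N_{M + 1}`. -/
theorem visitProb_projectedLaw_le (M n : ℕ) (y : Multiplicative ℤ) :
    visitProb projectedLaw n y ≤ lowProb M ^ n + (scale (M + 1) : ℝ≥0∞)⁻¹ := by
  induction n generalizing y with
  | zero =>
    rw [pow_zero]
    exact (visitProb_le_one _ _ _).trans le_self_add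
  | succ n ih =>
    rw [visitProb_succ, projectedLaw, expect_map, ← projectedLaw, expect_mixtureLaw,
      ← lowProb_mul_add]
    refine expect_indexLaw_le M (fun k _ => expect_le_of_le _ fun s _ => ih _) fun k hk => ?_
    refine (expect_stepLaw_translate_le (scale k) (sum_visitProb_le_one projectedLaw n) y).trans ?_
    gcongr
    exact scale_mono hk

theorem visitProb_projectedLaw_le_rpow {n : ℕ} (hn : 0 < n) (y : Multiplicative ℤ) :
    visitProb projectedLaw n y ≤ ENNReal.ofReal (9 * (1 / (n : ℝ) ^ (3 / 2 : ℝ))) := by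
  -- With this `M`, `16 ^ M ≤ n < 16 ^ (M + 1)`: then `4 ^ M ≤ √n` and `n ^ 2 ≤ N_{M + 1}`.
  set M := Nat.log 16 n with hM
  have hlow : 16 ^ M ≤ n := Nat.pow_log_le_self 16 hn.ne'
  have hhigh : n < 16 ^ (M + 1) := Nat.lt_pow_succ_log_self (by norm_num) n
  have hnpos : (0 : ℝ) < n := by exact_mod_cast hn
  have h4 : (4 : ℝ) ^ M ≤ √n := by
    refine Real.le_sqrt_of_sq_le ?_
    rw [← pow_mul, mul_comm, pow_mul]
    norm_num
    exact_mod_cast hlow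
  have hscale : (n : ℝ) ^ 2 ≤ scale (M + 1) := by
    have : n ^ 2 ≤ scale (M + 1) := by
      calc n ^ 2 ≤ (16 ^ (M + 1)) ^ 2 := by gcongr
        _ = 256 ^ (M + 1) := by rw [← pow_mul, mul_comm, pow_mul]; norm_num
        _ ≤ scale (M + 1) := Nat.pow_le_pow_right (by norm_num) (by nlinarith)
    exact_mod_cast this
  have hpos : (0 : ℝ) < scale (M + 1) := by exact_mod_cast Nat.pos_of_neZero (scale (M + 1))
  refine (visitProb_projectedLaw_le M n y).trans
    ((add_le_add_left (lowProb_pow_le M hn) _).trans ?_)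
  rw [← ENNReal.ofReal_natCast, ← ENNReal.ofReal_inv_of_pos hpos,
    ← ENNReal.ofReal_add (by positivity) (by positivity)]
  refine ENNReal.ofReal_le_ofReal ?_
  have hsqrt : 1 / (n : ℝ) ^ (3 / 2 : ℝ) = √n / n ^ 2 := by
    rw [Real.sqrt_eq_rpow, ← Real.rpow_natCast, ← Real.rpow_sub hnpos, one_div,
      ← Real.rpow_neg hnpos.le]
    norm_num
  have h1 : (1 : ℝ) ≤ √n := Real.one_le_sqrt.2 (by exact_mod_cast hn)
  calc 8 * 4 ^ M / (n : ℝ) ^ 2 + (scale (M + 1) : ℝ)⁻¹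
      ≤ 8 * √n / (n : ℝ) ^ 2 + √n / (n : ℝ) ^ 2 := by
        refine add_le_add (by gcongr) ?_
        rw [← one_div]
        gcongr
    _ = 9 * (1 / (n : ℝ) ^ (3 / 2 : ℝ)) := by
        rw [hsqrt]
        ring

theorem isTransientWalk_projectedLaw : IsTransientWalk projectedLaw := by
  refine isTransientWalk_of_tsum_visitProb _ fun y => ?_
  have hsum : Summable fun n : ℕ => 9 * (1 / ((n + 1 : ℕ) : ℝ) ^ (3 / 2 : ℝ)) :=
    ((summable_nat_add_iff 1).2 (Real.summable_one_div_nat_rpow.2 (by norm_num))).mul_left 9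
  rw [tsum_eq_zero_add' ENNReal.summable]
  refine ENNReal.add_ne_top.2 ⟨((visitProb_le_one _ _ _).trans_lt ENNReal.one_lt_top).ne, ?_⟩
  exact ne_top_of_le_ne_top hsum.tsum_ofReal_ne_top
    (ENNReal.tsum_le_tsum fun n => visitProb_projectedLaw_le_rpow n.succ_pos y)

end ScaleMixture

end Lampwalk

theorem mainTheorem6 :
    ∃ μ : PMF (Lampshuffler (Multiplicative ℤ)),
      IsNonDegenerateLaw μ ∧ IsSymmetricLaw μ ∧
      IsTransientWalk
        (μ.map (SemidirectProduct.rightHom : Lampshuffler (Multiplicative ℤ) →* Multiplicative ℤ)) ∧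
      HasTrivialPoissonBoundary μ :=
  ⟨Lampwalk.mixtureLaw, Lampwalk.isNonDegenerateLaw_mixtureLaw, Lampwalk.isSymmetricLaw_mixtureLaw,
    Lampwalk.isTransientWalk_projectedLaw,
    Lampwalk.hasTrivialPoissonBoundary_of_liouville _ fun _ => Lampwalk.harmonic_le⟩
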